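/- A gauge function is a nondecreasing, right-continuous function $g:[0,\infty)\to[0,\infty)$; for such $g$ and $S\subset\mathbb{R}$ put $$\mathcal{H}^g(S)=\lim_{\delta\to 0+}\ \inf\Big\{\sum_{i=1}^\infty g(\operatorname{diam} U_i)\,:\, S\subset\bigcup_{i=1}^\infty U_i \text{ and } \operatorname{diam} U_i<\delta \text{ for all } i\Big\},$$ where $\operatorname{diam}\emptyset=0$. Theorem. Let $A,B\subset\mathbb{R}$ be Borel (respectively, analytic) sets of Lebesgue measure zero, and assume that $B$ is of the second category in $\mathbb{R}$, i.e. not a countable union of nowhere dense sets. Then there are Borel (respectively, analytic) sets $B_1,B_2,A_1,A_2$ with $B=B_1\cup B_2$, $B_1\cap B_2=\emptyset$, $A=A_1\cup A_2$, $A_1\cap A_2=\emptyset$, and gauge functions $g_1,g_2$, such that $$\mathcal{H}^{g_1}(B_1)=1,\quad \mathcal{H}^{g_1}(A_1)=0,\quad \mathcal{H}^{g_2}(B_2)=1,\quad \mathcal{H}^{g_2}(A_2)=0.$$ -/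

import Mathlib

open MeasureTheory Set Filter Topology
open scoped NNReal ENNReal

/-- A gauge function: a nondecreasing, right continuous function `[0,∞) → [0,∞)`. -/
structure IsGauge (g : ℝ≥0 → ℝ≥0) : Prop where
  mono : Monotone g
  rightCts : ∀ x : ℝ≥0, ContinuousWithinAt g (Ici x) x

/-- The size-`δ` Hausdorff premeasure: the infimum of `∑ g (diam U i)` over all countable covers
`(U i)` of `A` by sets of diameter `< δ`. (A set of finite extended diameter is bounded and
`toNNReal` is then its diameter; the empty set has diameter `0`.) -/
noncomputable def gaugePre (g : ℝ≥0 → ℝ≥0) (δ : ℝ≥0∞) (A : Set ℝ) : ℝ≥0∞ :=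
  ⨅ (U : ℕ → Set ℝ) (_ : A ⊆ ⋃ i, U i) (_ : ∀ i, Metric.ediam (U i) < δ),
    ∑' i, (g (Metric.ediam (U i)).toNNReal : ℝ≥0∞)

/-- The Hausdorff measure with gauge function `g`. As the premeasure increases when `δ` decreases,
the limit as `δ → 0+` is the supremum over `δ > 0` (see `tendsto_gaugePre`). -/
noncomputable def gaugeHausdorff (g : ℝ≥0 → ℝ≥0) (A : Set ℝ) : ℝ≥0∞ :=
  ⨆ (δ : ℝ≥0∞) (_ : 0 < δ), gaugePre g δ A

theorem gaugePre_anti (g : ℝ≥0 → ℝ≥0) (A : Set ℝ) {δ δ' : ℝ≥0∞} (h : δ ≤ δ') :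
    gaugePre g δ' A ≤ gaugePre g δ A :=
  le_iInf fun U => le_iInf fun hA => le_iInf fun hU =>
    iInf_le_of_le U <| iInf_le_of_le hA <| iInf_le_of_le (fun i => (hU i).trans_le h) le_rfl

theorem tendsto_gaugePre (g : ℝ≥0 → ℝ≥0) (A : Set ℝ) :
    Tendsto (fun δ : ℝ≥0∞ => gaugePre g δ A) (𝓝[>] 0) (𝓝 (gaugeHausdorff g A)) := by
  rw [← tendsto_comp_coe_Ioi_atBot]
  simp only [gaugeHausdorff, iSup_subtype']
  exact tendsto_atBot_iSup fun r r' hr => gaugePre_anti g A hr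

/-!
Up to a meagre set `B` contains an interval intersected with a dense `G_δ` set `⋂ k, O k`, and for
generic `c` all the points `c + q` with `q` rational lie in every `O k`. The number `c + x` is close
to such a point if the binary digits of `x` vanish on a long enough gap `[a k, b k)`, so a Cantor
set of numbers `c + x` whose free digits avoid suitable gaps lies in `B`. It carries a gauge of
positive finite measure, which is at most linear, with slope `2 ^ b k`, from the scale of one gap
down to the scale of the next.

Each point of the null set `N = A ∪ B` lies in infinitely many of some closed sets `E i` with
`∑ diam (E i) < ∞`. After `b k` has been chosen, pick a tail of `∑ diam (E i)` that is small
compared with `2 ^ (-b k)`, and then the next gap so deep that all sets before that tail that are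
not single points are larger than the scale of the gap. Using the even gaps for one Cantor set and
the odd gaps for the other, each gauge is summable over every second block of the sets `E i`, and
every point of `N` is covered infinitely often by blocks of one of the two kinds.
-/

section MkMetric

variable {X : Type*} [EMetricSpace X] [MeasurableSpace X] [BorelSpace X] {m : ℝ≥0∞ → ℝ≥0∞}

theorem volume_image_le_mkMetric_image {α : Type*} (hm : MonotoneOn m (Iio ∞)) {φ : α → X}
    {ψ : α → ℝ} (hψ : ∀ x y, edist (ψ x) (ψ y) ≤ m (edist (φ x) (φ y))) (s : Set α) :
    volume (ψ '' s) ≤ Measure.mkMetric m (φ '' s) := by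
  rw [Measure.mkMetric_apply]
  refine le_iSup₂_of_le 1 one_pos (le_iInf fun U => le_iInf₂ fun hU hU1 => ?_)
  have hcover : ψ '' s ⊆ ⋃ i, ψ '' (φ ⁻¹' U i) := by
    rintro _ ⟨x, hx, rfl⟩
    obtain ⟨i, hi⟩ := mem_iUnion.1 (hU (mem_image_of_mem φ hx))
    exact mem_iUnion.2 ⟨i, x, hi, rfl⟩
  refine (measure_mono hcover).trans ((measure_iUnion_le _).trans ?_)
  refine ENNReal.tsum_le_tsum fun i => ?_
  rcases (U i).eq_empty_or_nonempty with hi | hi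
  · simp [hi]
  refine (Real.volume_le_diam _).trans (Metric.ediam_le ?_) |>.trans (le_iSup_of_le hi le_rfl)
  rintro _ ⟨x, hx, rfl⟩ _ ⟨y, hy, rfl⟩
  have hdiam : Metric.ediam (U i) < ∞ := (hU1 i).trans_lt ENNReal.one_lt_top
  have hxy : edist (φ x) (φ y) ≤ Metric.ediam (U i) := Metric.edist_le_ediam_of_mem hx hy
  exact (hψ x y).trans (hm (hxy.trans_lt hdiam) hdiam hxy)

/-- A Borel–Cantelli lemma: the complements of the finite index sets give ever finer covers. -/
theorem mkMetric_eq_zero_of_frequently_mem {ι : Type*} [Countable ι] {E : ι → Set X}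
    (hE : ∑' i, Metric.ediam (E i) ≠ ∞) (hmE : ∑' i, m (Metric.ediam (E i)) ≠ ∞) {S : Set X}
    (hS : ∀ x ∈ S, ∃ᶠ i in cofinite, x ∈ E i) : Measure.mkMetric m S = 0 := by
  have hcover (t : Finset ι) : S ⊆ ⋃ i : {i // i ∉ t}, E i := fun x hx => by
    obtain ⟨i, hi, hxi⟩ :=
      ((hS x hx).and_eventually t.eventually_cofinite_notMem).exists
    exact mem_iUnion.2 ⟨⟨i, hxi⟩, hi⟩
  refine le_antisymm ((Measure.mkMetric_le_liminf_tsum S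
    (fun t : Finset ι => ∑' i : {i // i ∉ t}, Metric.ediam (E i))
    (ENNReal.tendsto_tsum_compl_atTop_zero hE) (fun (t : Finset ι) (i : {i // i ∉ t}) => E i)
    (.of_forall fun t i => ENNReal.le_tsum i) (.of_forall hcover) m).trans ?_) zero_le
  exact (ENNReal.tendsto_tsum_compl_atTop_zero hmE).liminf_eq.le

end MkMetric

theorem gaugeHausdorff_eq_mkMetric {g : ℝ≥0 → ℝ≥0} (hg : g 0 = 0) (S : Set ℝ) :
    gaugeHausdorff g S = Measure.mkMetric (fun d => (g d.toNNReal : ℝ≥0∞)) S := by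
  have hterm (U : Set ℝ) : ⨆ _ : U.Nonempty, (g (Metric.ediam U).toNNReal : ℝ≥0∞) =
      g (Metric.ediam U).toNNReal := by
    rcases U.eq_empty_or_nonempty with rfl | hU
    · simp [hg]
    · simp [hU]
  simp only [gaugeHausdorff, gaugePre, Measure.mkMetric_apply, hterm]
  refine le_antisymm (iSup₂_le fun δ hδ => ?_) (iSup₂_mono fun δ _ => ?_)
  · obtain ⟨r, hr, hrδ⟩ := exists_between hδ
    refine le_iSup₂_of_le r hr (iInf_mono fun U => iInf_mono fun _ => ?_)
    exact iInf_mono' fun hU => ⟨fun i => (hU i).trans_lt hrδ, le_rfl⟩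
  · refine iInf_mono fun U => iInf_mono fun _ => ?_
    exact iInf_mono' fun hU => ⟨fun i => (hU i).le, le_rfl⟩

theorem tendsto_inv_two_pow_nhds_zero :
    Tendsto (fun n : ℕ => ((2 : ℝ≥0) ^ n)⁻¹) atTop (𝓝 0) := by
  simpa using tendsto_pow_atTop_nhds_zero_of_lt_one (r := (2⁻¹ : ℝ≥0)) (by simp) (by norm_num)

section Digits

/-- The integer with binary digits `d 0, …, d (n - 1)`, the leading digit being `d 0`. -/
def prefixNat (d : ℕ → Fin 2) : ℕ → ℕ
  | 0 => 0
  | n + 1 => 2 * prefixNat d n + d n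

theorem two_pow_mul_ofDigits (d : ℕ → Fin 2) (n : ℕ) :
    2 ^ n * Real.ofDigits d = prefixNat d n + Real.ofDigits fun i => d (i + n) := by
  induction n with
  | zero => simp [prefixNat]
  | succ n ih =>
    have hshift := Real.ofDigits_eq_sum_add_ofDigits (fun i => d (i + n)) 1
    simp only [Finset.sum_range_one, Real.ofDigitsTerm, zero_add, pow_one, Nat.cast_ofNat,
      add_assoc, add_comm 1 n] at hshift
    rw [pow_succ', mul_assoc, ih, hshift, prefixNat]
    push_cast
    ring

theorem prefixNat_lt (d : ℕ → Fin 2) (n : ℕ) : prefixNat d n < 2 ^ n := by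
  induction n with
  | zero => simp [prefixNat]
  | succ n ih =>
    rw [prefixNat, pow_succ']
    omega

theorem prefixNat_eq_two_pow_mul {d : ℕ → Fin 2} {a b : ℕ} (hab : a ≤ b)
    (hd : ∀ i ∈ Ico a b, d i = 0) : prefixNat d b = 2 ^ (b - a) * prefixNat d a := by
  induction b, hab using Nat.le_induction with
  | base => simp
  | succ b hab ih =>
    rw [prefixNat, hd b ⟨hab, b.lt_succ_self⟩,
      ih fun i hi => hd i ⟨hi.1, hi.2.trans b.lt_succ_self⟩, Nat.sub_add_comm hab, pow_succ']
    simp [mul_assoc]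

theorem exists_ofDigits_eq_div_add {d : ℕ → Fin 2} {a b : ℕ} (hab : a ≤ b)
    (hd : ∀ i ∈ Ico a b, d i = 0) :
    ∃ q < 2 ^ a, ∃ t ∈ Icc (0 : ℝ) ((2 ^ b)⁻¹), Real.ofDigits d = (q : ℕ) / 2 ^ a + t := by
  refine ⟨prefixNat d a, prefixNat_lt d a, (2 ^ b)⁻¹ * Real.ofDigits fun i => d (i + b),
    ⟨mul_nonneg (by positivity) (Real.ofDigits_nonneg _),
      mul_le_of_le_one_right (by positivity) (Real.ofDigits_le_one _)⟩, ?_⟩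
  have hb := two_pow_mul_ofDigits d b
  rw [prefixNat_eq_two_pow_mul hab hd] at hb
  have hpow : (2 : ℝ) ^ b = 2 ^ (b - a) * 2 ^ a := by rw [← pow_add, Nat.sub_add_cancel hab]
  push_cast at hb
  rw [div_add' _ _ _ (by positivity), eq_div_iff (by positivity)]
  field_simp
  linear_combination 2 ^ a * hb - prefixNat d a * hpow

theorem dist_two_pow_mul_abs_ofDigits_sub_le (d d' : ℕ → Fin 2) (n : ℕ) :
    dist (2 ^ n * |Real.ofDigits d - Real.ofDigits d'|) |(prefixNat d n : ℝ) - prefixNat d' n| ≤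
      1 := by
  have htail : 2 ^ n * (Real.ofDigits d - Real.ofDigits d') - (prefixNat d n - prefixNat d' n) =
      (Real.ofDigits fun i => d (i + n)) - Real.ofDigits fun i => d' (i + n) := by
    linear_combination two_pow_mul_ofDigits d n - two_pow_mul_ofDigits d' n
  rw [← abs_of_pos (show (0 : ℝ) < 2 ^ n by positivity), ← abs_mul]
  refine (abs_abs_sub_abs_le _ _).trans ?_
  rw [htail]
  exact abs_sub_le_of_nonneg_of_le (Real.ofDigits_nonneg _) (Real.ofDigits_le_one _)
    (Real.ofDigits_nonneg _) (Real.ofDigits_le_one _)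

end Digits

section Cantor

open Classical in
/-- Copies the digits `d` in order into the free positions, those in `F`, and puts `0` elsewhere.
The position `i ∈ F` is preceded by `Nat.count (· ∈ F) i` free positions. -/
noncomputable def spread (F : Set ℕ) (d : ℕ → Fin 2) (i : ℕ) : Fin 2 :=
  if i ∈ F then d (Nat.count (· ∈ F) i) else 0

/-- The Cantor set of the numbers `c + x`, where `x ∈ [0, 1]` has a binary expansion whose digits
vanish outside of the set `F` of free positions. -/
def digitCantorSet (c : ℝ) (F : Set ℕ) : Set ℝ := range fun d => c + Real.ofDigits (spread F d)

variable {F : Set ℕ}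

theorem spread_of_notMem {i : ℕ} (hi : i ∉ F) (d : ℕ → Fin 2) : spread F d i = 0 := if_neg hi

theorem continuous_spread (F : Set ℕ) : Continuous (spread F) := by
  refine continuous_pi fun i => ?_
  unfold spread
  split_ifs
  exacts [continuous_apply _, continuous_const]

theorem isCompact_digitCantorSet (c : ℝ) (F : Set ℕ) : IsCompact (digitCantorSet c F) :=
  isCompact_range (continuous_const.add (Real.continuous_ofDigits.comp (continuous_spread F)))

open Classical in
/-- The two differences of prefixes vanish together and otherwise have the same sign, which makes
the comparison of their sizes stable under appending a digit. -/
theorem abs_prefixNat_count_sub_le (F : Set ℕ) (d d' : ℕ → Fin 2) (n : ℕ) :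
    |(prefixNat d (Nat.count (· ∈ F) n) : ℤ) - prefixNat d' (Nat.count (· ∈ F) n)| ≤
      |(prefixNat (spread F d) n : ℤ) - prefixNat (spread F d') n| := by
  set S : ℕ → ℤ := fun n =>
    prefixNat d (Nat.count (· ∈ F) n) - prefixNat d' (Nat.count (· ∈ F) n) with hS
  set T : ℕ → ℤ := fun n => prefixNat (spread F d) n - prefixNat (spread F d') n with hT
  have hsign : ∀ n, S n = 0 ∧ T n = 0 ∨ 1 ≤ S n ∧ S n ≤ T n ∨ T n ≤ S n ∧ S n ≤ -1 := by
    intro n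
    induction n with
    | zero => simp [S, T, prefixNat]
    | succ n ih =>
      by_cases hn : n ∈ F
      · simp only [hS, hT, Nat.count_succ, hn, if_true, prefixNat, spread] at ih ⊢
        omega
      · simp only [hS, hT, Nat.count_succ, hn, if_false, prefixNat, spread, add_zero,
          Fin.val_zero] at ih ⊢
        omega
  change |S n| ≤ |T n|
  rcases hsign n with h | h | h <;> grind

open Classical in
theorem two_pow_count_mul_abs_ofDigits_sub_le (F : Set ℕ) (d d' : ℕ → Fin 2) (n : ℕ) :
    2 ^ Nat.count (· ∈ F) n * |Real.ofDigits d - Real.ofDigits d'| ≤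
      2 + |Real.ofDigits (spread F d) - Real.ofDigits (spread F d')| * 2 ^ n := by
  have hle : |(prefixNat d (Nat.count (· ∈ F) n) : ℝ) - prefixNat d' (Nat.count (· ∈ F) n)| ≤
      |(prefixNat (spread F d) n : ℝ) - prefixNat (spread F d') n| :=
    mod_cast abs_prefixNat_count_sub_le F d d' n
  linarith [(abs_le.1 (dist_two_pow_mul_abs_ofDigits_sub_le d d' (Nat.count (· ∈ F) n))).2,
    (abs_le.1 (dist_two_pow_mul_abs_ofDigits_sub_le (spread F d) (spread F d') n)).1]

open Classical in
/-- Up to a constant factor the gauge for which `digitCantorSet c F` has positive finite measure: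
the `2 ^ count` cells of level `n` have diameter at most `2⁻ⁿ`. Taking an infimum of affine
functions makes it right continuous. -/
noncomputable def cantorGauge (F : Set ℕ) (r : ℝ≥0) : ℝ≥0 :=
  ⨅ n : ℕ, (2 ^ Nat.count (· ∈ F) n)⁻¹ * (2 + r * 2 ^ n)

open Classical in
theorem cantorGauge_le (n : ℕ) (r : ℝ≥0) :
    cantorGauge F r ≤ (2 ^ Nat.count (· ∈ F) n)⁻¹ * (2 + r * 2 ^ n) :=
  ciInf_le (OrderBot.bddBelow _) n

theorem isGauge_cantorGauge (F : Set ℕ) : IsGauge (cantorGauge F) := by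
  classical
  have hmono : Monotone (cantorGauge F) := fun r s h =>
    le_ciInf fun n => (cantorGauge_le n r).trans (by gcongr)
  refine ⟨hmono, fun x => tendsto_order.2 ⟨fun c hc => ?_, fun c hc => ?_⟩⟩
  · filter_upwards [self_mem_nhdsWithin] with y hy using hc.trans_le (hmono hy)
  · obtain ⟨n, hn⟩ := exists_lt_of_ciInf_lt hc
    have hcont : Continuous fun r : ℝ≥0 =>
        (2 ^ Nat.count (· ∈ F) n)⁻¹ * (2 + r * 2 ^ n) := by fun_prop
    filter_upwards [nhdsWithin_le_nhds ((hcont.tendsto x).eventually_lt_const hn)] with y hy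
      using (cantorGauge_le n y).trans_lt hy

theorem cantorGauge_zero (hF : F.Infinite) : cantorGauge F 0 = 0 := by
  classical
  refine nonpos_iff_eq_zero.1 <| le_of_forall_pos_le_add fun ε hε => ?_
  obtain ⟨k, hk⟩ := exists_nat_gt (2 / ε)
  have hcount : Nat.count (· ∈ F) (Nat.nth (· ∈ F) k) = k :=
    Nat.count_nth_of_infinite (p := (· ∈ F)) hF k
  have hle := cantorGauge_le (F := F) (Nat.nth (· ∈ F) k) 0
  rw [hcount, zero_mul, add_zero] at hle
  rw [zero_add]
  refine hle.trans ?_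
  rw [inv_mul_le_iff₀ (by positivity)]
  rw [div_lt_iff₀ hε] at hk
  exact hk.le.trans (by gcongr; exact_mod_cast k.lt_two_pow_self.le)

open Classical in
theorem cantorGauge_le_mul_div {n : ℕ} {r : ℝ≥0} (hr : (2 ^ n)⁻¹ ≤ r) :
    cantorGauge F r ≤ 3 * r * (2 ^ n / 2 ^ Nat.count (· ∈ F) n) := by
  have hr1 : 1 ≤ r * 2 ^ n := by rwa [inv_le_iff_one_le_mul₀ (by positivity)] at hr
  calc cantorGauge F r ≤ (2 ^ Nat.count (· ∈ F) n)⁻¹ * (2 * 1 + r * 2 ^ n) := by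
        simpa using cantorGauge_le n r
    _ ≤ (2 ^ Nat.count (· ∈ F) n)⁻¹ * (2 * (r * 2 ^ n) + r * 2 ^ n) := by gcongr
    _ = 3 * r * (2 ^ n / 2 ^ Nat.count (· ∈ F) n) := by ring

theorem edist_ofDigits_le_cantorGauge (F : Set ℕ) (d d' : ℕ → Fin 2) :
    edist (Real.ofDigits d) (Real.ofDigits d') ≤ cantorGauge F
      (edist (Real.ofDigits (spread F d)) (Real.ofDigits (spread F d'))).toNNReal := by
  classical
  rw [edist_nndist, edist_nndist, ENNReal.toNNReal_coe, ENNReal.coe_le_coe]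
  refine le_ciInf fun n => ?_
  rw [le_inv_mul_iff₀ (by positivity), ← NNReal.coe_le_coe]
  simpa [Real.dist_eq] using two_pow_count_mul_abs_ofDigits_sub_le F d d' n

theorem one_le_gaugeHausdorff_digitCantorSet (hF : F.Infinite) (c : ℝ) :
    1 ≤ gaugeHausdorff (cantorGauge F) (digitCantorSet c F) := by
  have hm : MonotoneOn (fun r : ℝ≥0∞ => (cantorGauge F r.toNNReal : ℝ≥0∞)) (Iio ∞) :=
    fun r _ s hs hrs => by
      simpa using (isGauge_cantorGauge F).mono (ENNReal.toNNReal_mono (ne_of_lt hs) hrs)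
  have hψ (d d' : ℕ → Fin 2) : edist (Real.ofDigits d) (Real.ofDigits d') ≤ cantorGauge F
      (edist (c + Real.ofDigits (spread F d)) (c + Real.ofDigits (spread F d'))).toNNReal := by
    simpa using edist_ofDigits_le_cantorGauge F d d'
  calc (1 : ℝ≥0∞) = volume (Icc (0 : ℝ) 1) := by simp
    _ ≤ volume (Real.ofDigits '' (univ : Set (ℕ → Fin 2))) :=
        measure_mono (Real.ofDigits_SurjOn one_lt_two)
    _ ≤ _ := volume_image_le_mkMetric_image hm hψ univ
    _ = gaugeHausdorff (cantorGauge F) (digitCantorSet c F) := by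
        rw [gaugeHausdorff_eq_mkMetric (cantorGauge_zero hF), image_univ, digitCantorSet]

open Classical in
theorem ediam_image_cell_le (c : ℝ) (F : Set ℕ) (n : ℕ) (w : Fin (Nat.count (· ∈ F) n) → Fin 2) :
    Metric.ediam ((fun d => c + Real.ofDigits (spread F d)) '' {d | ∀ i, d (Fin.val i) = w i}) ≤
      ((2 ^ n)⁻¹ : ℝ≥0) := by
  refine Metric.ediam_le ?_
  rintro _ ⟨d, hd, rfl⟩ _ ⟨d', hd', rfl⟩
  have hagree : ∀ i < n, spread F d i = spread F d' i := fun i hi => by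
    unfold spread
    split_ifs with hiF
    · have hcount := Nat.count_strict_mono (p := (· ∈ F)) hiF hi
      exact (hd ⟨_, hcount⟩).trans (hd' ⟨_, hcount⟩).symm
    · rfl
  rw [edist_nndist, ENNReal.coe_le_coe, ← NNReal.coe_le_coe]
  simpa [Real.dist_eq] using Real.abs_ofDigits_sub_ofDigits_le hagree

theorem gaugeHausdorff_digitCantorSet_le (hF : F.Infinite) (c : ℝ) :
    gaugeHausdorff (cantorGauge F) (digitCantorSet c F) ≤ 3 := by
  classical
  rw [gaugeHausdorff_eq_mkMetric (cantorGauge_zero hF)]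
  let cell (n : ℕ) (w : Fin (Nat.count (· ∈ F) n) → Fin 2) : Set ℝ :=
    (fun d => c + Real.ofDigits (spread F d)) '' {d | ∀ i, d (Fin.val i) = w i}
  have hr : Tendsto (fun n : ℕ => (((2 ^ n)⁻¹ : ℝ≥0) : ℝ≥0∞)) atTop (𝓝 0) :=
    ENNReal.tendsto_coe.2 tendsto_inv_two_pow_nhds_zero
  have hcover (n : ℕ) : digitCantorSet c F ⊆ ⋃ w, cell n w := by
    rintro _ ⟨d, rfl⟩
    exact mem_iUnion.2 ⟨fun i => d i, d, fun i => rfl, rfl⟩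
  refine (Measure.mkMetric_le_liminf_sum _ _ hr cell (.of_forall (ediam_image_cell_le c F))
    (.of_forall hcover) _).trans (Filter.liminf_le_of_le (by isBoundedDefault) fun b hb => ?_)
  obtain ⟨n, hn⟩ := hb.exists
  refine hn.trans ?_
  have hcell (w) : (cantorGauge F (Metric.ediam (cell n w)).toNNReal : ℝ≥0∞) ≤
      ((2 ^ Nat.count (· ∈ F) n)⁻¹ * 3 : ℝ≥0) := by
    have hdiam := ENNReal.toNNReal_mono ENNReal.coe_ne_top (ediam_image_cell_le c F n w)
    rw [ENNReal.coe_le_coe]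
    refine ((isGauge_cantorGauge F).mono hdiam).trans ((cantorGauge_le n _).trans_eq ?_)
    rw [ENNReal.toNNReal_coe, inv_mul_cancel₀ (by positivity)]
    norm_num
  refine (Finset.sum_le_sum fun w _ => hcell w).trans ?_
  simp only [Finset.sum_const, Finset.card_univ, Fintype.card_pi_const, Fintype.card_fin,
    nsmul_eq_mul]
  norm_cast
  rw [mul_inv_cancel_left₀ (by positivity)]

theorem IsGauge.const_mul {g : ℝ≥0 → ℝ≥0} (hg : IsGauge g) (c : ℝ≥0) :
    IsGauge fun r => c * g r :=
  ⟨fun _ _ hrs => mul_le_mul_right (hg.mono hrs) c, fun r => (hg.rightCts r).const_mul c⟩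

theorem gaugeHausdorff_const_mul {g : ℝ≥0 → ℝ≥0} (hg : g 0 = 0) {c : ℝ≥0} (hc : c ≠ 0)
    (S : Set ℝ) : gaugeHausdorff (fun r => c * g r) S = c * gaugeHausdorff g S := by
  have hsmul : (fun d : ℝ≥0∞ => ((c * g d.toNNReal : ℝ≥0) : ℝ≥0∞)) =
      c • fun d : ℝ≥0∞ => (g d.toNNReal : ℝ≥0∞) := by
    ext d
    simp [ENNReal.smul_def]
  rw [gaugeHausdorff_eq_mkMetric hg, gaugeHausdorff_eq_mkMetric (by simp [hg]), hsmul,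
    ← OuterMeasure.coe_mkMetric, OuterMeasure.mkMetric_nnreal_smul _ hc,
    ← OuterMeasure.coe_mkMetric]
  rfl

theorem exists_isGauge_gaugeHausdorff_digitCantorSet_eq_one (hF : F.Infinite) (c : ℝ) :
    ∃ g, IsGauge g ∧ g ≤ cantorGauge F ∧ gaugeHausdorff g (digitCantorSet c F) = 1 := by
  have hone := one_le_gaugeHausdorff_digitCantorSet hF c
  have htop : gaugeHausdorff (cantorGauge F) (digitCantorSet c F) ≠ ∞ :=
    ((gaugeHausdorff_digitCantorSet_le hF c).trans_lt (by simp)).ne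
  lift gaugeHausdorff (cantorGauge F) (digitCantorSet c F) to ℝ≥0 using htop with γ hγ
  have hγ1 : 1 ≤ γ := mod_cast hone
  have hγ0 : γ ≠ 0 := (one_pos.trans_le hγ1).ne'
  refine ⟨fun r => γ⁻¹ * cantorGauge F r, (isGauge_cantorGauge F).const_mul γ⁻¹,
    fun r => mul_le_of_le_one_left zero_le (inv_le_one_of_one_le₀ hγ1), ?_⟩
  rw [gaugeHausdorff_const_mul (cantorGauge_zero hF) (inv_ne_zero hγ0), ← hγ]
  exact_mod_cast inv_mul_cancel₀ hγ0

theorem cantorGauge_le_of_Ico_subset {b n : ℕ} (hbn : b ≤ n) (hF : Ico b n ⊆ F) {r : ℝ≥0}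
    (hr : (2 ^ n)⁻¹ ≤ r) : cantorGauge F r ≤ 3 * r * 2 ^ b := by
  classical
  have hcount : n ≤ b + Nat.count (· ∈ F) n := by
    have hshift : Nat.count (fun k => b + k ∈ F) (n - b) = n - b :=
      Nat.count_iff_forall.2 fun k hk => hF ⟨b.le_add_right k, by omega⟩
    obtain ⟨m, rfl⟩ := Nat.exists_eq_add_of_le hbn
    rw [Nat.count_add]
    simp only [Nat.add_sub_cancel_left] at hshift
    omega
  refine (cantorGauge_le_mul_div hr).trans ?_
  gcongr
  rw [div_le_iff₀ (by positivity), ← pow_add]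
  exact pow_le_pow_right₀ one_le_two hcount

end Cantor

section NullSet

theorem gaugeHausdorff_eq_zero_of_frequently_mem {g : ℝ≥0 → ℝ≥0} (hg : g 0 = 0) {I : Set ℕ}
    {E : ℕ → Set ℝ} (hE : ∑' i, Metric.ediam (E i) ≠ ∞)
    (hgE : ∑' i : I, (g (Metric.ediam (E i)).toNNReal : ℝ≥0∞) ≠ ∞) {S : Set ℝ}
    (hS : ∀ x ∈ S, ∃ᶠ i in atTop, i ∈ I ∧ x ∈ E i) : gaugeHausdorff g S = 0 := by
  rw [gaugeHausdorff_eq_mkMetric hg]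
  refine mkMetric_eq_zero_of_frequently_mem (E := fun i : I => E i) (ne_top_of_le_ne_top hE
    (ENNReal.tsum_comp_le_tsum_of_injective Subtype.val_injective fun i => Metric.ediam (E i)))
    hgE fun x hx => ?_
  rw [← Subtype.val_injective.comap_cofinite_eq, frequently_comap, Nat.cofinite_eq_atTop]
  exact (hS x hx).mono fun i hi => ⟨⟨i, hi.1⟩, rfl, hi.2⟩

theorem exists_cover_tsum_ediam_lt {N : Set ℝ} (hN : volume N = 0) {ε : ℝ≥0∞} (hε : 0 < ε) :
    ∃ t : ℕ → Set ℝ, N ⊆ ⋃ n, t n ∧ ∑' n, Metric.ediam (t n) < ε := by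
  have hpre : ⨅ (t : ℕ → Set ℝ) (_ : N ⊆ ⋃ n, t n) (_ : ∀ n, Metric.ediam (t n) ≤ 1),
      ∑' n, ⨆ _ : (t n).Nonempty, Metric.ediam (t n) ^ (1 : ℝ) < ε := by
    rw [← hausdorffMeasure_real, Measure.hausdorffMeasure_apply] at hN
    exact ((le_iSup₂ (f := fun (r : ℝ≥0∞) (_ : 0 < r) =>
      ⨅ (t : ℕ → Set ℝ) (_ : N ⊆ ⋃ n, t n) (_ : ∀ n, Metric.ediam (t n) ≤ r),
        ∑' n, ⨆ _ : (t n).Nonempty, Metric.ediam (t n) ^ (1 : ℝ))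
      1 one_pos).trans_eq hN).trans_lt hε
  simp only [iInf_lt_iff] at hpre
  obtain ⟨t, ht, -, hlt⟩ := hpre
  refine ⟨t, ht, lt_of_le_of_lt (ENNReal.tsum_le_tsum fun n => ?_) hlt⟩
  rcases (t n).eq_empty_or_nonempty with h | h <;> simp [h]

theorem exists_isClosed_frequently_mem_of_volume_eq_zero {N : Set ℝ} (hN : volume N = 0) :
    ∃ E : ℕ → Set ℝ, (∀ n, IsClosed (E n)) ∧ ∑' n, Metric.ediam (E n) ≠ ∞ ∧
      ∀ x ∈ N, ∃ᶠ n in atTop, x ∈ E n := by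
  obtain ⟨ε, hε0, hε⟩ := ENNReal.exists_pos_sum_of_countable' one_ne_zero ℕ
  choose t htN ht using fun j => exists_cover_tsum_ediam_lt hN (hε0 j)
  refine ⟨fun n => closure (t n.unpair.1 n.unpair.2), fun n => isClosed_closure, ?_,
    fun x hx => frequently_atTop.2 fun m => ?_⟩
  · have hpair := Nat.pairEquiv.symm.tsum_eq fun p : ℕ × ℕ => Metric.ediam (t p.1 p.2)
    simp only [Nat.pairEquiv_symm_apply] at hpair
    simp only [Metric.ediam_closure]
    rw [hpair, ENNReal.tsum_prod']
    exact ((ENNReal.tsum_le_tsum fun j => (ht j).le).trans_lt (hε.trans ENNReal.one_lt_top)).ne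
  · obtain ⟨i, hi⟩ := mem_iUnion.1 (htN m hx)
    exact ⟨Nat.pair m i, Nat.left_le_pair m i, by simpa using subset_closure hi⟩

/-- On scales `r ≥ 2⁻ᵃ⁽ʲ⁾` the gauge `g` is at most linear with slope of order `2ᵇ⁽ʲ⁾`. A large
`a j` for a given `b j` forces `g` to stay small down to very small scales. -/
def LinearOnScales (g : ℝ≥0 → ℝ≥0) (a b : ℕ → ℕ) : Prop :=
  ∃ D : ℝ≥0, ∀ j r, (2 ^ a j)⁻¹ ≤ r → g r ≤ D * r * 2 ^ b j

theorem LinearOnScales.tsum_ne_top {g : ℝ≥0 → ℝ≥0} {a b n m : ℕ → ℕ} {ρ : ℕ → ℝ≥0}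
    (hg : LinearOnScales g a b) (hg0 : g 0 = 0)
    (hρ : ∀ j, ∀ i ∈ Finset.Ico (n j) (m j), ρ i = 0 ∨ (2 ^ a j)⁻¹ ≤ ρ i)
    (hsum : ∀ j, 2 ^ b j * ∑ i ∈ Finset.Ico (n j) (m j), ρ i ≤ (1 / 2) ^ j) :
    ∑' i : ⋃ j, (Finset.Ico (n j) (m j) : Set ℕ), (g (ρ i) : ℝ≥0∞) ≠ ∞ := by
  obtain ⟨D, hD⟩ := hg
  have hblock (j : ℕ) : ∑ i ∈ Finset.Ico (n j) (m j), g (ρ i) ≤ D * (1 / 2) ^ j :=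
    calc ∑ i ∈ Finset.Ico (n j) (m j), g (ρ i)
        ≤ ∑ i ∈ Finset.Ico (n j) (m j), D * ρ i * 2 ^ b j := by
          refine Finset.sum_le_sum fun i hi => ?_
          rcases hρ j i hi with h | h
          · simp [h, hg0]
          · exact hD j _ h
      _ = D * (2 ^ b j * ∑ i ∈ Finset.Ico (n j) (m j), ρ i) := by
          rw [Finset.mul_sum, Finset.mul_sum]
          exact Finset.sum_congr rfl fun i _ => by ring
      _ ≤ D * (1 / 2) ^ j := by gcongr; exact hsum j
  have hgeom : Summable fun j : ℕ => D * (1 / 2 : ℝ≥0) ^ j :=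
    (NNReal.summable_geometric (by norm_num)).mul_left D
  refine ne_top_of_le_ne_top (ENNReal.tsum_coe_ne_top_iff_summable.2 hgeom) ?_
  refine (ENNReal.tsum_iUnion_le_tsum (fun i => (g (ρ i) : ℝ≥0∞)) _).trans
    (ENNReal.tsum_le_tsum fun j => ?_)
  refine (Finset.tsum_subtype' _ fun i => (g (ρ i) : ℝ≥0∞)).trans_le ?_
  exact_mod_cast hblock j

theorem exists_forall_two_pow_mul_sum_Ico_le {ρ : ℕ → ℝ≥0} (hρ : Summable ρ) (k b : ℕ) :
    ∃ n ≥ k, ∀ m, 2 ^ b * ∑ i ∈ Finset.Ico n m, ρ i ≤ (1 / 2) ^ k := by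
  have hε : (0 : ℝ≥0) < (2 ^ b)⁻¹ * (1 / 2) ^ k := by positivity
  obtain ⟨n, hn, hnk⟩ := (((NNReal.tendsto_sum_nat_add ρ).eventually_lt_const hε).and
    (eventually_ge_atTop k)).exists
  refine ⟨n, hnk, fun m => ?_⟩
  rw [← le_inv_mul_iff₀ (by positivity), Finset.sum_Ico_eq_sum_range]
  simp only [add_comm n]
  exact (((NNReal.summable_nat_add_iff n).2 hρ).sum_le_tsum _ fun i _ => zero_le).trans hn.le

theorem exists_forall_lt_eq_zero_or_le (ρ : ℕ → ℝ≥0) (n : ℕ) :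
    ∃ h : ℕ, ∀ i < n, ρ i = 0 ∨ (2 ^ h)⁻¹ ≤ ρ i := by
  have hsmall (i : ℕ) : ∀ᶠ h : ℕ in atTop, ρ i = 0 ∨ (2 ^ h)⁻¹ ≤ ρ i := by
    rcases eq_or_ne (ρ i) 0 with hi | hi
    · exact .of_forall fun _ => .inl hi
    exact (tendsto_inv_two_pow_nhds_zero.eventually_le_const (pos_iff_ne_zero.2 hi)).mono
      fun _ => .inr
  have hall := (finite_Iio n).eventually_all.2 fun i _ => hsmall i
  exact hall.exists

theorem exists_mem_Ico_succ {n : ℕ → ℕ} (hn : ∀ k, k ≤ n k) {i : ℕ} (hi : n 0 ≤ i) :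
    ∃ k, i ∈ Finset.Ico (n k) (n (k + 1)) := by
  have hex : ∃ k, i < n k := ⟨i + 1, hn _⟩
  obtain ⟨k, hk⟩ := Nat.exists_eq_succ_of_ne_zero
    (fun h0 : Nat.find hex = 0 => (h0 ▸ Nat.find_spec hex).not_ge hi)
  refine ⟨k, Finset.mem_Ico.2 ⟨not_lt.1 (Nat.find_min hex (by omega)), ?_⟩⟩
  rw [← Nat.succ_eq_add_one, ← hk]
  exact Nat.find_spec hex

/-- The covering sets are grouped into consecutive blocks, and a point belongs to `L` or not
according to whether it is covered infinitely often by the even blocks. -/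
theorem exists_measurableSet_gaugeHausdorff_eq_zero {N : Set ℝ} (hN : volume N = 0) :
    ∃ h : ℕ → ℕ → ℕ, ∀ a b : ℕ → ℕ, (∀ k, h k (b k) ≤ a (k + 1)) → ∃ L, MeasurableSet L ∧
      (∀ g, g 0 = 0 → LinearOnScales g (fun j => a (2 * j + 2)) (fun j => b (2 * j)) →
        gaugeHausdorff g (N ∩ L) = 0) ∧
      ∀ g, g 0 = 0 → LinearOnScales g (fun j => a (2 * j + 3)) (fun j => b (2 * j + 1)) →
        gaugeHausdorff g (N \ L) = 0 := by
  obtain ⟨E, hEc, hE, hNE⟩ := exists_isClosed_frequently_mem_of_volume_eq_zero hN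
  set ρ : ℕ → ℝ≥0 := fun i => (Metric.ediam (E i)).toNNReal
  have hρ : Summable ρ := ENNReal.summable_toNNReal_of_tsum_ne_top hE
  choose ν hν hνsum using exists_forall_two_pow_mul_sum_Ico_le hρ
  choose h hh using fun k b => exists_forall_lt_eq_zero_or_le ρ (ν k b)
  refine ⟨h, fun a b hab => ?_⟩
  set n : ℕ → ℕ := fun k => ν k (b k)
  let I (e : ℕ) : Set ℕ := ⋃ j, (Finset.Ico (n (2 * j + e)) (n (2 * j + e + 1)) : Set ℕ)
  have hnull (e : ℕ) {g : ℝ≥0 → ℝ≥0} (hg0 : g 0 = 0)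
      (hg : LinearOnScales g (fun j => a (2 * j + e + 2)) (fun j => b (2 * j + e)))
      {S : Set ℝ} (hS : ∀ x ∈ S, ∃ᶠ i in atTop, i ∈ I e ∧ x ∈ E i) : gaugeHausdorff g S = 0 := by
    have hsum : ∑' i : I e, (g (ρ i) : ℝ≥0∞) ≠ ∞ :=
      hg.tsum_ne_top hg0 (fun j i hi => ?_) fun j => ?_
    · exact gaugeHausdorff_eq_zero_of_frequently_mem hg0 hE hsum hS
    · refine (hh _ _ i (Finset.mem_Ico.1 hi).2).imp_right (le_trans ?_)
      gcongr
      exacts [one_le_two, hab _]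
    · exact (hνsum _ _ _).trans (pow_le_pow_of_le_one zero_le (by norm_num) (by omega))
  have hI : ∀ᶠ i in atTop, i ∈ I 0 ∨ i ∈ I 1 := by
    filter_upwards [eventually_ge_atTop (n 0)] with i hi
    obtain ⟨k, hk⟩ := exists_mem_Ico_succ (fun k => hν k (b k)) hi
    obtain ⟨j, rfl | rfl⟩ := k.even_or_odd'
    exacts [.inl (mem_iUnion.2 ⟨j, hk⟩), .inr (mem_iUnion.2 ⟨j, hk⟩)]
  refine ⟨limsup (fun i => {x | i ∈ I 0 ∧ x ∈ E i}) atTop, .measurableSet_limsup fun i =>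
    (MeasurableSet.const _).inter (hEc i).measurableSet, fun g hg0 hg => hnull 0 hg0 hg fun x hx =>
    mem_limsup_iff_frequently_mem.1 hx.2, fun g hg0 hg => hnull 1 hg0 hg fun x hx => ?_⟩
  have hfin := not_frequently.1 (mt mem_limsup_iff_frequently_mem.2 hx.2)
  exact ((hNE x hx.1).and_eventually (hI.and hfin)).mono
    fun i ⟨hxi, hi, hi0⟩ => ⟨hi.resolve_left fun h0 => hi0 ⟨h0, hxi⟩, hxi⟩

end NullSet

section BaireProperty

theorem diff_iUnion_diff_iUnion_cons_subset {α : Type*} (E : List ℕ → Set α) :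
    E [] \ ⋃ s, (E s \ ⋃ n, E (n :: s)) ⊆ ⋃ z : ℕ → ℕ, ⋂ k, E (PiNat.res z k) := by
  rintro x ⟨hx, hxE⟩
  have hstep (s : {s // x ∈ E s}) : ∃ n, x ∈ E (n :: s) := by
    by_contra h
    exact hxE (mem_iUnion.2 ⟨s, s.2, by simpa using h⟩)
  choose ν hν using hstep
  let s : ℕ → {s // x ∈ E s} := fun k => k.rec ⟨[], hx⟩ fun _ s => ⟨ν s :: s, hν s⟩
  have hs (k : ℕ) : PiNat.res (fun i => ν (s i)) k = (s k).1 := by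
    induction k with
    | zero => rfl
    | succ k ih => rw [PiNat.res_succ, ih]
  exact mem_iUnion.2 ⟨_, mem_iInter.2 fun k => hs k ▸ (s k).2⟩

/-- The points at which `S` is locally of the second category. -/
def nonmeagreAt {X : Type*} [TopologicalSpace X] (S : Set X) : Set X :=
  {x | ∀ V ∈ 𝓝 x, ¬ IsMeagre (S ∩ V)}

variable {X : Type*} [TopologicalSpace X]

theorem isClosed_nonmeagreAt (S : Set X) : IsClosed (nonmeagreAt S) := by
  rw [← isOpen_compl_iff, isOpen_iff_mem_nhds]
  intro x hx
  simp only [nonmeagreAt, mem_compl_iff, mem_ofPred_eq, not_forall, not_not] at hx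
  obtain ⟨V, hV, hSV⟩ := hx
  filter_upwards [eventually_mem_nhds_iff.2 hV] with y hy hyS using hyS V hy hSV

theorem baireMeasurableSet_nonmeagreAt (S : Set X) : BaireMeasurableSet (nonmeagreAt S) :=
  (isClosed_nonmeagreAt S).isOpen_compl.baireMeasurableSet.of_compl

theorem nonmeagreAt_subset_closure (S : Set X) : nonmeagreAt S ⊆ closure S := by
  refine fun x hx => mem_closure_iff_nhds.2 fun V hV => nonempty_iff_ne_empty.2 fun h => ?_
  exact hx V hV (by rw [inter_comm, h]; exact IsMeagre.empty)

theorem isMeagre_diff_nonmeagreAt [SecondCountableTopology X] (S : Set X) :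
    IsMeagre (S \ nonmeagreAt S) := by
  have hc : {V ∈ TopologicalSpace.countableBasis X | IsMeagre (S ∩ V)}.Countable :=
    (TopologicalSpace.countable_countableBasis X).mono fun V hV => hV.1
  refine IsMeagre.mono ?_ (isMeagre_biUnion hc (f := fun V => S ∩ V) fun V hV => hV.2)
  rintro x ⟨hxS, hx⟩
  simp only [nonmeagreAt, mem_ofPred_eq, not_forall, not_not] at hx
  obtain ⟨V, hV, hSV⟩ := hx
  obtain ⟨W, hW, hxW, hWV⟩ := (TopologicalSpace.isBasis_countableBasis X).mem_nhds_iff.1 hV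
  exact mem_biUnion ⟨hW, hSV.mono (inter_subset_inter_right S hWV)⟩ ⟨hxS, hxW⟩

theorem isMeagre_nonmeagreAt_diff {S T : Set X} (hT : BaireMeasurableSet T) (hST : S ⊆ T) :
    IsMeagre (nonmeagreAt S \ T) := by
  obtain ⟨U, hU, hTU⟩ := ((baireMeasurableSet_nonmeagreAt S).diff hT).residualEq_isOpen
  have hSU : IsMeagre (S ∩ U) := by
    filter_upwards [hTU] with x hx hxSU using (hx.mpr hxSU.2).2 (hST hxSU.1)
  filter_upwards [hTU] with x hx hxT
  exact hxT.1 U (hU.mem_nhds (hx.mp hxT)) hSU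

theorem exists_baireMeasurableSet_minimal_superset [SecondCountableTopology X] (S : Set X) :
    ∃ E, S ⊆ E ∧ E ⊆ closure S ∧ BaireMeasurableSet E ∧
      ∀ T, BaireMeasurableSet T → S ⊆ T → IsMeagre (E \ T) := by
  refine ⟨S ∪ nonmeagreAt S, subset_union_left,
    union_subset subset_closure (nonmeagreAt_subset_closure S), ?_, fun T hT hST => ?_⟩
  · rw [← sdiff_union_self]
    exact (isMeagre_diff_nonmeagreAt S).baireMeasurableSet.union (baireMeasurableSet_nonmeagreAt S)
  · rw [union_sdiff_distrib, sdiff_eq_empty.2 hST, empty_union]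
    exact isMeagre_nonmeagreAt_diff hT hST

theorem iInter_closure_image_cylinder_subset [T2Space X] {f : (ℕ → ℕ) → X} (hf : Continuous f)
    (α : ℕ → ℕ) : ⋂ k, closure (f '' PiNat.cylinder α k) ⊆ {f α} := by
  intro x hx
  by_contra hne
  obtain ⟨P, hP, Q, hQ, hPQ⟩ := Filter.disjoint_iff.1 (disjoint_nhds_nhds.2 (Ne.symm hne))
  obtain ⟨_, ⟨β, k, rfl⟩, hαβ, hβP⟩ :=
    (PiNat.isTopologicalBasis_cylinders fun _ : ℕ => ℕ).mem_nhds_iff.1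
      (hf.continuousAt.preimage_mem_nhds hP)
  rw [← PiNat.mem_cylinder_iff_eq.1 hαβ] at hβP
  obtain ⟨_, hyQ, γ, hγ, rfl⟩ := mem_closure_iff_nhds.1 (mem_iInter.1 hx k) Q hQ
  exact disjoint_left.1 hPQ (hβP hγ) hyQ

theorem baireMeasurableSet_of_analyticSet [T2Space X] [SecondCountableTopology X] {S : Set X}
    (hS : AnalyticSet S) : BaireMeasurableSet S := by
  rw [AnalyticSet] at hS
  obtain rfl | ⟨f, hf, rfl⟩ := hS
  · exact IsMeagre.empty.baireMeasurableSet
  let F (s : List ℕ) : Set X := f '' {x | PiNat.res x s.length = s}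
  have hF (s : List ℕ) : F s ⊆ ⋃ n, F (n :: s) := by
    rintro _ ⟨x, hx, rfl⟩
    exact mem_iUnion.2 ⟨x s.length, x, by simp [PiNat.res_succ, hx.out], rfl⟩
  have hFres (α : ℕ → ℕ) (k : ℕ) : F (PiNat.res α k) = f '' PiNat.cylinder α k := by
    simp only [F, PiNat.res_length, PiNat.cylinder_eq_res]
  choose E hFE hEF hE hEmin using fun s => exists_baireMeasurableSet_minimal_superset (F s)
  have hmeagre : IsMeagre (⋃ s, (E s \ ⋃ n, E (n :: s))) := isMeagre_iUnion fun s =>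
    hEmin s _ (.iUnion fun n => hE _) ((hF s).trans (iUnion_mono fun n => hFE _))
  have hbranch : ⋃ α : ℕ → ℕ, ⋂ k, E (PiNat.res α k) ⊆ range f := iUnion_subset fun α => by
    have hsub : ⋂ k, E (PiNat.res α k) ⊆ {f α} :=
      (iInter_mono fun k => hFres α k ▸ hEF _).trans (iInter_closure_image_cylinder_subset hf α)
    exact hsub.trans (singleton_subset_iff.2 ⟨α, rfl⟩)
  have hF0 : F [] = range f := by simp [F]
  refine (hE []).congr ?_
  filter_upwards [hmeagre] with x hx
  refine propext ⟨fun h => ?_, fun h => (hF0 ▸ hFE [] :) h⟩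
  exact hbranch (diff_iUnion_diff_iUnion_cons_subset E ⟨h, hx⟩)

theorem analyticSet_inter [T2Space X] {S T : Set X} (hS : AnalyticSet S) (hT : AnalyticSet T) :
    AnalyticSet (S ∩ T) := by
  rw [inter_eq_iInter]
  exact AnalyticSet.iInter (Bool.forall_bool.2 ⟨hT, hS⟩)

end BaireProperty

section Positions

/-- The digit positions between consecutive gaps, the gaps being the intervals `[a j, b j)`. -/
def freePositions (a b : ℕ → ℕ) : Set ℕ := ⋃ j, Ico (b j) (a (j + 1))

variable {a b : ℕ → ℕ}

theorem strictMono_of_lt_of_lt_succ (hab : ∀ j, a j < b j) (hba : ∀ j, b j < a (j + 1)) :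
    StrictMono a :=
  strictMono_nat_of_lt_succ fun j => (hab j).trans (hba j)

theorem infinite_freePositions (hab : ∀ j, a j < b j) (hba : ∀ j, b j < a (j + 1)) :
    (freePositions a b).Infinite := by
  refine infinite_of_not_bddAbove fun ⟨M, hM⟩ => ?_
  have hMb : b M ≤ M := hM (mem_iUnion.2 ⟨M, le_rfl, hba M⟩)
  exact ((strictMono_of_lt_of_lt_succ hab hba).le_apply.trans_lt (hab M)).not_ge hMb

theorem disjoint_freePositions_Ico (hab : ∀ j, a j < b j) (hba : ∀ j, b j < a (j + 1)) (j : ℕ) :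
    Disjoint (freePositions a b) (Ico (a j) (b j)) := by
  have hmono := (strictMono_of_lt_of_lt_succ hab hba).monotone
  refine disjoint_iUnion_left.2 fun k => disjoint_left.2 fun i hi hi' => ?_
  rcases lt_or_ge k j with hkj | hjk
  · exact (hi.2.trans_le ((hmono hkj).trans hi'.1)).false
  · rcases hjk.eq_or_lt with rfl | hjk
    · exact (hi'.2.trans_le hi.1).false
    · exact ((hi'.2.trans (hba j)).trans_le ((hmono hjk).trans ((hab k).le.trans hi.1))).false

theorem linearOnScales_of_le_cantorGauge (hba : ∀ j, b j < a (j + 1)) {g : ℝ≥0 → ℝ≥0}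
    (hg : g ≤ cantorGauge (freePositions a b)) :
    LinearOnScales g (fun j => a (j + 1)) b :=
  ⟨3, fun j r hr => (hg r).trans <|
    cantorGauge_le_of_Ico_subset (hba j).le (subset_iUnion_of_subset j le_rfl) hr⟩

theorem exists_isGauge_linearOnScales (hab : ∀ j, a j < b j) (hba : ∀ j, b j < a (j + 1)) (c : ℝ) :
    ∃ g, IsGauge g ∧ g 0 = 0 ∧ LinearOnScales g (fun j => a (j + 1)) b ∧
      gaugeHausdorff g (digitCantorSet c (freePositions a b)) = 1 := by
  have hF := infinite_freePositions hab hba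
  obtain ⟨g, hg, hgF, hg1⟩ := exists_isGauge_gaugeHausdorff_digitCantorSet_eq_one hF c
  exact ⟨g, hg, nonpos_iff_eq_zero.1 ((hgF 0).trans_eq (cantorGauge_zero hF)),
    linearOnScales_of_le_cantorGauge hba hgF, hg1⟩

theorem digitCantorSet_subset {F : Set ℕ} {a b : ℕ} (hab : a ≤ b) (hF : Disjoint F (Ico a b))
    {c : ℝ} {O : Set ℝ}
    (hO : ∀ q < 2 ^ a, ∀ t ∈ Icc (0 : ℝ) (2 ^ b)⁻¹, c + ((q : ℕ) / 2 ^ a + t) ∈ O) :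
    digitCantorSet c F ⊆ O := by
  rintro _ ⟨d, rfl⟩
  obtain ⟨q, hq, t, ht, hqt⟩ := exists_ofDigits_eq_div_add hab (d := spread F d)
    fun i hi => spread_of_notMem (disjoint_right.1 hF hi) d
  simpa only [hqt] using hO q hq t ht

theorem digitCantorSet_freePositions_subset_Icc (hab : ∀ j, a j < b j)
    (hba : ∀ j, b j < a (j + 1)) {m : ℕ} (hm : m ≤ a 0) (c : ℝ) :
    digitCantorSet c (freePositions a b) ⊆ Icc c (c + (2 ^ m)⁻¹) := by
  have hmem {i : ℕ} (hi : i ∈ freePositions a b) : m ≤ i := by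
    obtain ⟨j, hj⟩ := mem_iUnion.1 hi
    exact hm.trans <| ((strictMono_of_lt_of_lt_succ hab hba).monotone j.zero_le).trans <|
      (hab j).le.trans hj.1
  refine digitCantorSet_subset m.zero_le (disjoint_left.2 fun i hi hi' => ?_) ?_
  · exact hi'.2.not_ge (hmem hi)
  · simp +contextual

theorem digitCantorSet_freePositions_subset_iInter (hab : ∀ j, a j < b j)
    (hba : ∀ j, b j < a (j + 1)) {c : ℝ} {O : ℕ → Set ℝ}
    (hO : ∀ j, ∀ q < 2 ^ a j, ∀ t ∈ Icc (0 : ℝ) (2 ^ b j)⁻¹, c + ((q : ℕ) / 2 ^ a j + t) ∈ O j) :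
    digitCantorSet c (freePositions a b) ⊆ ⋂ j, O j :=
  subset_iInter fun j =>
    digitCantorSet_subset (hab j).le (disjoint_freePositions_Ico hab hba j) (hO j)

theorem exists_gaps {P : ℕ → ℕ → ℕ → Prop} (hP : ∀ k a, ∀ᶠ b in atTop, P k a b)
    (h : ℕ → ℕ → ℕ) (N : ℕ) : ∃ a b : ℕ → ℕ, a 0 = N ∧ (∀ k, a k < b k) ∧
      (∀ k, b k < a (k + 1)) ∧ (∀ k, h k (b k) ≤ a (k + 1)) ∧ ∀ k, P k (a k) (b k) := by
  choose β hβ hPβ using fun k a => ((eventually_gt_atTop a).and (hP k a)).exists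
  let a : ℕ → ℕ := fun k => k.rec N fun k a => max (h k (β k a)) (β k a + 1)
  exact ⟨a, fun k => β k (a k), rfl, fun k => hβ k _, fun k => le_max_right (h k _) _,
    fun k => le_max_left _ (β k _ + 1), fun k => hPβ k _⟩

end Positions

section Generic

theorem exists_mem_forall_add_mem_of_mem_residual {G : Type*} [AddGroup G] [TopologicalSpace G]
    [ContinuousAdd G] [BaireSpace G] {R : Set G} (hR : R ∈ residual G) {D : Set G}
    (hD : D.Countable) {W : Set G} (hW : IsOpen W) (hne : W.Nonempty) :
    ∃ c ∈ W, ∀ x ∈ D, c + x ∈ R := by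
  have hall : {c | ∀ x ∈ D, c + x ∈ R} ∈ residual G := by
    refine (eventually_countable_ball hD).2 fun x _ => ?_
    exact tendsto_residual_of_isOpenMap (continuous_add_const x) (isOpenMap_add_right x) hR
  exact (dense_of_mem_residual hall).inter_open_nonempty W hW hne

theorem eventually_forall_add_mem {O : Set ℝ} (hO : IsOpen O) {x : ℝ} (hx : x ∈ O) :
    ∀ᶠ b : ℕ in atTop, ∀ t ∈ Icc (0 : ℝ) (2 ^ b)⁻¹, x + t ∈ O := by
  have hpow : Tendsto (fun b : ℕ => ((2 : ℝ) ^ b)⁻¹) atTop (𝓝 0) := by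
    simpa using NNReal.tendsto_coe.2 tendsto_inv_two_pow_nhds_zero
  obtain ⟨ε, hε, hball⟩ := Metric.isOpen_iff.1 hO x hx
  filter_upwards [hpow.eventually_lt_const hε] with b hb t ht
  exact hball (by simpa [abs_of_nonneg ht.1] using ht.2.trans_lt hb)

theorem eventually_forall_add_div_two_pow_mem {O : Set ℝ} (hO : IsOpen O) {c : ℝ}
    (hc : ∀ q : ℚ, c + q ∈ O) (a : ℕ) : ∀ᶠ b : ℕ in atTop, ∀ q < 2 ^ a,
      ∀ t ∈ Icc (0 : ℝ) (2 ^ b)⁻¹, c + ((q : ℕ) / 2 ^ a + t) ∈ O := by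
  refine (finite_Iio (2 ^ a)).eventually_all.2 fun q _ => ?_
  have hmem : c + (q : ℕ) / 2 ^ a ∈ O := by simpa using hc (q / 2 ^ a)
  exact (eventually_forall_add_mem hO hmem).mono fun b hb t ht => by simpa [add_assoc] using hb t ht

theorem exists_isOpen_inter_iInter_subset {X : Type*} [TopologicalSpace X] [BaireSpace X]
    {B : Set X} (hB : BaireMeasurableSet B) (hB2 : ¬ IsMeagre B) :
    ∃ (U : Set X) (O : ℕ → Set X), IsOpen U ∧ U.Nonempty ∧ (∀ k, IsOpen (O k)) ∧
      ⋂ k, O k ∈ residual X ∧ U ∩ ⋂ k, O k ⊆ B := by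
  obtain ⟨U, hU, hBU⟩ := hB.residualEq_isOpen
  obtain ⟨G, hG, hGδ, hGd⟩ := mem_residual.1 hBU
  obtain ⟨O, hO, rfl⟩ := hGδ.eq_iInter_nat
  refine ⟨U, O, hU, nonempty_iff_ne_empty.2 ?_, hO, residual_of_dense_Gδ hGδ hGd, fun x hx => ?_⟩
  · rintro rfl
    exact hB2 (eventuallyEq_empty.1 hBU)
  · exact (hG hx.2).mpr hx.1

theorem exists_Icc_inter_iInter_subset {B : Set ℝ} (hB : BaireMeasurableSet B)
    (hB2 : ¬ IsMeagre B) :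
    ∃ (c : ℝ) (N : ℕ) (O : ℕ → Set ℝ), (∀ k, IsOpen (O k)) ∧ (∀ (q : ℚ) k, c + q ∈ O k) ∧
      Icc c (c + (2 ^ N)⁻¹) ∩ ⋂ k, O k ⊆ B := by
  obtain ⟨U, O, hU, hUne, hO, hOres, hUO⟩ := exists_isOpen_inter_iInter_subset hB hB2
  obtain ⟨c, hcU, hc⟩ :=
    exists_mem_forall_add_mem_of_mem_residual hOres (countable_range ((↑) : ℚ → ℝ)) hU hUne
  obtain ⟨N, hN⟩ := (eventually_forall_add_mem hU hcU).exists
  refine ⟨c, N, O, hO, fun q => mem_iInter.1 (hc q ⟨q, rfl⟩), fun x hx => hUO ⟨?_, hx.2⟩⟩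
  simpa using hN (x - c) ⟨sub_nonneg.2 hx.1.1, sub_le_iff_le_add'.2 hx.1.2⟩

theorem exists_disjoint_digitCantorSet_subset {B : Set ℝ} (hB : BaireMeasurableSet B)
    (hB2 : ¬ IsMeagre B) (h : ℕ → ℕ → ℕ) :
    ∃ (a b : ℕ → ℕ) (c c' : ℝ), (∀ k, a k < b k) ∧ (∀ k, b k < a (k + 1)) ∧
      (∀ k, h k (b k) ≤ a (k + 1)) ∧
      digitCantorSet c (freePositions (fun j => a (2 * j)) fun j => b (2 * j)) ⊆ B ∧
      digitCantorSet c' (freePositions (fun j => a (2 * j + 1)) fun j => b (2 * j + 1)) ⊆ B ∧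
      Disjoint (digitCantorSet c (freePositions (fun j => a (2 * j)) fun j => b (2 * j)))
        (digitCantorSet c' (freePositions (fun j => a (2 * j + 1)) fun j => b (2 * j + 1))) := by
  obtain ⟨c, N, O, hO, hc, hNB⟩ := exists_Icc_inter_iInter_subset hB hB2
  have hc' (q : ℚ) (k : ℕ) : c + (2 ^ (N + 1))⁻¹ + q ∈ O k := by
    have := hc ((2 ^ (N + 1))⁻¹ + q) k
    push_cast at this
    rwa [add_assoc]
  obtain ⟨a, b, ha, hab, hba, hh, hP⟩ := exists_gaps (fun k a =>
    (eventually_forall_add_div_two_pow_mem (hO (k / 2)) (hc · _) a).and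
      (eventually_forall_add_div_two_pow_mem (hO (k / 2)) (hc' · _) a)) h (N + 2)
  have hba' (k : ℕ) : b k < a (k + 2) := ((hba k).trans (hab _)).trans (hba _)
  have ha1 : N + 2 ≤ a 1 := ha ▸ ((hab 0).trans (hba 0)).le
  have hpow : (0 : ℝ) < (2 ^ (N + 2))⁻¹ ∧ ((2 : ℝ) ^ (N + 1))⁻¹ = 2 * (2 ^ (N + 2))⁻¹ ∧
      ((2 : ℝ) ^ N)⁻¹ = 4 * (2 ^ (N + 2))⁻¹ := by
    refine ⟨by positivity, ?_, ?_⟩ <;> field_simp <;> ring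
  have hK := digitCantorSet_freePositions_subset_Icc (a := fun j => a (2 * j))
    (b := fun j => b (2 * j)) (fun _ => hab _) (fun _ => hba' _) ha.ge c
  have hK' := digitCantorSet_freePositions_subset_Icc (a := fun j => a (2 * j + 1))
    (b := fun j => b (2 * j + 1)) (fun _ => hab _) (fun _ => hba' _) ha1 (c + (2 ^ (N + 1))⁻¹)
  refine ⟨a, b, c, c + (2 ^ (N + 1))⁻¹, hab, hba, hh,
    fun x hx => hNB ⟨⟨(hK hx).1, by linarith [(hK hx).2]⟩, ?_⟩,
    fun x hx => hNB ⟨⟨by linarith [(hK' hx).1], by linarith [(hK' hx).2]⟩, ?_⟩,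
    disjoint_left.2 fun x hx hx' => by linarith [(hK hx).2, (hK' hx').1]⟩
  · refine digitCantorSet_freePositions_subset_iInter (fun _ => hab _) (fun _ => hba' _)
      (fun j => ?_) hx
    simpa only [Nat.mul_div_cancel_left j two_pos] using (hP (2 * j)).1
  · refine digitCantorSet_freePositions_subset_iInter (fun _ => hab _) (fun _ => hba' _)
      (fun j => ?_) hx
    have hdiv : (2 * j + 1) / 2 = j := by lia
    simpa only [hdiv] using (hP (2 * j + 1)).2

end Generic

section Partition

theorem gaugeHausdorff_mono (g : ℝ≥0 → ℝ≥0) {S T : Set ℝ} (hST : S ⊆ T) :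
    gaugeHausdorff g S ≤ gaugeHausdorff g T :=
  iSup₂_mono fun _ _ => le_iInf fun U => le_iInf fun hT => le_iInf fun hU =>
    iInf₂_le_of_le U (hST.trans hT) (iInf_le _ hU)

theorem gaugeHausdorff_eq_of_subset_union {g : ℝ≥0 → ℝ≥0} (hg : g 0 = 0) {K S T : Set ℝ}
    (hKS : K ⊆ S) (hST : S ⊆ K ∪ T) (hT : gaugeHausdorff g T = 0) :
    gaugeHausdorff g S = gaugeHausdorff g K := by
  refine (gaugeHausdorff_mono g hST).trans ?_ |>.antisymm (gaugeHausdorff_mono g hKS)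
  simp only [gaugeHausdorff_eq_mkMetric hg] at hT ⊢
  exact (measure_union_le K T).trans_eq (by rw [hT, add_zero])

theorem exists_isCompact_disjoint_gaugeHausdorff_eq_one {N B : Set ℝ} (hN : volume N = 0)
    (hB : BaireMeasurableSet B) (hB2 : ¬ IsMeagre B) :
    ∃ (K₁ K₂ L : Set ℝ) (g₁ g₂ : ℝ≥0 → ℝ≥0), IsCompact K₁ ∧ IsCompact K₂ ∧ MeasurableSet L ∧
      K₁ ⊆ B ∧ K₂ ⊆ B ∧ Disjoint K₁ K₂ ∧ IsGauge g₁ ∧ g₁ 0 = 0 ∧ IsGauge g₂ ∧ g₂ 0 = 0 ∧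
      gaugeHausdorff g₁ K₁ = 1 ∧ gaugeHausdorff g₁ (N ∩ L) = 0 ∧
      gaugeHausdorff g₂ K₂ = 1 ∧ gaugeHausdorff g₂ (N \ L) = 0 := by
  obtain ⟨h, hL⟩ := exists_measurableSet_gaugeHausdorff_eq_zero hN
  obtain ⟨a, b, c₁, c₂, hab, hba, hha, hK₁, hK₂, hK⟩ :=
    exists_disjoint_digitCantorSet_subset hB hB2 h
  obtain ⟨L, hLm, hL₁, hL₂⟩ := hL a b hha
  have hba' (k : ℕ) : b k < a (k + 2) := ((hba k).trans (hab _)).trans (hba _)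
  obtain ⟨g₁, hg₁, hg₁0, hg₁l, hg₁K⟩ := exists_isGauge_linearOnScales
    (a := fun j => a (2 * j)) (b := fun j => b (2 * j)) (fun _ => hab _) (fun _ => hba' _) c₁
  obtain ⟨g₂, hg₂, hg₂0, hg₂l, hg₂K⟩ := exists_isGauge_linearOnScales
    (a := fun j => a (2 * j + 1)) (b := fun j => b (2 * j + 1)) (fun _ => hab _)
    (fun _ => hba' _) c₂
  exact ⟨_, _, L, g₁, g₂, isCompact_digitCantorSet _ _, isCompact_digitCantorSet _ _, hLm,
    hK₁, hK₂, hK, hg₁, hg₁0, hg₂, hg₂0, hg₁K, hL₁ g₁ hg₁0 hg₁l, hg₂K, hL₂ g₂ hg₂0 hg₂l⟩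

end Partition

theorem theorem2p4_general {C : Set ℝ → Prop} (hC : ∀ S T, C S → MeasurableSet T → C (S ∩ T))
    {A B : Set ℝ} (hA : C A) (hB : C B) (hBb : BaireMeasurableSet B)
    (hA0 : volume A = 0) (hB0 : volume B = 0) (hB2 : ¬ IsMeagre B) :
    ∃ (B₁ B₂ A₁ A₂ : Set ℝ) (g₁ g₂ : ℝ≥0 → ℝ≥0),
      C B₁ ∧ C B₂ ∧ C A₁ ∧ C A₂ ∧
      B = B₁ ∪ B₂ ∧ Disjoint B₁ B₂ ∧ A = A₁ ∪ A₂ ∧ Disjoint A₁ A₂ ∧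
      IsGauge g₁ ∧ IsGauge g₂ ∧
      gaugeHausdorff g₁ B₁ = 1 ∧ gaugeHausdorff g₁ A₁ = 0 ∧
      gaugeHausdorff g₂ B₂ = 1 ∧ gaugeHausdorff g₂ A₂ = 0 := by
  obtain ⟨K₁, K₂, L, g₁, g₂, hK₁, hK₂, hL, hK₁B, hK₂B, hK, hg₁, hg₁0, hg₂, hg₂0, hg₁K, hg₁L,
    hg₂K, hg₂L⟩ := exists_isCompact_disjoint_gaugeHausdorff_eq_one
      (measure_union_null hA0 hB0) hBb hB2
  let M := K₁ ∪ L \ K₂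
  have hM : MeasurableSet M := hK₁.measurableSet.union (hL.diff hK₂.measurableSet)
  have hdisj (S T : Set ℝ) : Disjoint (S ∩ T) (S ∩ Tᶜ) :=
    disjoint_compl_right.mono inter_subset_right inter_subset_right
  have hKM : K₂ ⊆ Mᶜ := fun x hx h => h.elim (disjoint_left.1 hK · hx) fun h => h.2 hx
  have hBM₁ : B ∩ M ⊆ K₁ ∪ (A ∪ B) ∩ L :=
    fun x hx => hx.2.imp id fun h => ⟨.inr hx.1, h.1⟩
  have hBM₂ : B ∩ Mᶜ ⊆ K₂ ∪ (A ∪ B) \ L := fun x hx =>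
    or_iff_not_imp_left.2 fun h => ⟨.inr hx.1, fun hxL => hx.2 (.inr ⟨hxL, h⟩)⟩
  refine ⟨B ∩ M, B ∩ Mᶜ, A ∩ L, A ∩ Lᶜ, g₁, g₂, hC _ _ hB hM, hC _ _ hB hM.compl, hC _ _ hA hL,
    hC _ _ hA hL.compl, (inter_union_compl B M).symm, hdisj B M, (inter_union_compl A L).symm,
    hdisj A L, hg₁, hg₂, ?_, ?_, ?_, ?_⟩
  · exact (gaugeHausdorff_eq_of_subset_union hg₁0 (subset_inter hK₁B subset_union_left) hBM₁
      hg₁L).trans hg₁K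
  · exact nonpos_iff_eq_zero.1
      ((gaugeHausdorff_mono g₁ (inter_subset_inter_left L subset_union_left)).trans_eq hg₁L)
  · exact (gaugeHausdorff_eq_of_subset_union hg₂0 (subset_inter hK₂B hKM) hBM₂ hg₂L).trans hg₂K
  · exact nonpos_iff_eq_zero.1
      ((gaugeHausdorff_mono g₂ (inter_subset_inter_left Lᶜ subset_union_left)).trans_eq hg₂L)

theorem theorem2p4 (C : Set ℝ → Prop)
    (hC : C = (fun S : Set ℝ => MeasurableSet S) ∨ C = (fun S : Set ℝ => AnalyticSet S))
    (A B : Set ℝ) (hA : C A) (hB : C B) (hA0 : volume A = 0) (hB0 : volume B = 0)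
    (hB2 : ¬ IsMeagre B) :
    ∃ (B₁ B₂ A₁ A₂ : Set ℝ) (g₁ g₂ : ℝ≥0 → ℝ≥0),
      C B₁ ∧ C B₂ ∧ C A₁ ∧ C A₂ ∧
      B = B₁ ∪ B₂ ∧ Disjoint B₁ B₂ ∧ A = A₁ ∪ A₂ ∧ Disjoint A₁ A₂ ∧
      IsGauge g₁ ∧ IsGauge g₂ ∧
      gaugeHausdorff g₁ B₁ = 1 ∧ gaugeHausdorff g₁ A₁ = 0 ∧
      gaugeHausdorff g₂ B₂ = 1 ∧ gaugeHausdorff g₂ A₂ = 0 := by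
  rcases hC with rfl | rfl
  · exact theorem2p4_general (fun _ _ => MeasurableSet.inter) hA hB
      (MeasurableSet.baireMeasurableSet hB) hA0 hB0 hB2
  · exact theorem2p4_general (fun _ _ hS hT => analyticSet_inter hS hT.analyticSet) hA hB
      (baireMeasurableSet_of_analyticSet hB) hA0 hB0 hB2
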